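/- Let $N$ be a lattice of rank $d$ and $N_{\mathbb R}=N\otimes_{\mathbb Z}\mathbb R$. Let $\Sigma$ be a simplicial rational fan in $N_{\mathbb R}$ that is complete, i.e. its support $|\Sigma|$ (the union of its cones) is all of $N_{\mathbb R}$. Let $\rho_1,\dots,\rho_r$ be the rays of $\Sigma$, with primitive lattice generators $v_1,\dots,v_r$, and let $b_i=a_iv_i$ for some positive integers $a_i$. Let $\psi:|\Sigma|\to\mathbb R$ be the function that is linear on each cone of $\Sigma$ and satisfies $\psi(b_i)=1$ for all $i$, and put $Q=\{v\in|\Sigma| : \psi(v)\le 1\}$. For a lattice point $v\in|\Sigma|\cap N$ let $w_0(v)=\psi(v)-\lceil\psi(v)\rceil$. For $k\in\mathbb Q$ and an integer $m\ge 0$ let $f^0_k(m)$ be the number of $v\in mQ\cap N$ with $w_0(v)=k$, and put $$\delta^0_k(t)=(1-t)^{d+1}\sum_{m\ge 0}f^0_k(m)\,t^m .$$ Then every $\delta^0_k(t)$ is a polynomial with integer coefficients, it is nonzero for only finitely many $k$, and it is zero unless $-1<k\le 0$. Write $\delta^0(t)=\sum_{k\in\mathbb Q}\delta^0_k(t)\,t^k=\sum_{-1<k\le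 0}\delta^0_k(t)\,t^k$, a finite sum of integer multiples of rational powers of $t$. The following hold: 1. $\delta^0_0(t)$ has degree $d$, and its coefficients of $t^0,t^1,\dots,t^d$ are all positive integers. 2. $\delta^0(t)=t^d\,\delta^0(t^{-1})$. 3. $\delta^0_0(t)=t^d\,\delta^0_0(t^{-1})$. 4. For every rational $k$ with $-1<k<0$ one can write $\delta^0_k(t)=t\,\tilde\delta_k(t)$ with $\tilde\delta_k(t)\in\mathbb Z[t]$, and $\tilde\delta_k(t)=t^{d-1}\,\tilde\delta_{-1-k}(t^{-1})$ for all such $k$. -/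

import Mathlib

open scoped TensorProduct Pointwise

namespace WeightedEhrhart

/-- The real vector space `N_ℝ = N ⊗ ℝ` of a lattice `N`. -/
abbrev RealSpan (N : Type*) [AddCommGroup N] : Type _ := ℝ ⊗[ℤ] N

/-- The canonical map `N → N_ℝ` (injective when `N` is a lattice). -/
def latticePoint {N : Type*} [AddCommGroup N] (v : N) : RealSpan N := (1 : ℝ) ⊗ₜ[ℤ] v

/-- A lattice vector is primitive if it is not a proper multiple of a lattice vector
(in particular it is nonzero, since `0 = 2 • 0`). -/
def IsPrimitive {N : Type*} [AddCommGroup N] (v : N) : Prop :=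
  ∀ (n : ℕ) (w : N), v = n • w → n = 1

/-- The dimension of a cone: the dimension of its linear span. -/
noncomputable def coneDim {N : Type*} [AddCommGroup N] (σ : PointedCone ℝ (RealSpan N)) : ℕ :=
  Module.finrank ℝ (Submodule.span ℝ (σ : Set (RealSpan N)))

/-- A rational fan in `N_ℝ`: a nonempty finite collection of strongly convex rational polyhedral
cones, closed under taking faces, any two of which meet in a common face. -/
structure RationalFan (N : Type*) [AddCommGroup N] where
  cones : Set (PointedCone ℝ (RealSpan N))
  finite : cones.Finite
  nonempty : cones.Nonempty
  rational : ∀ σ ∈ cones, ∃ G : Finset N, σ = PointedCone.hull ℝ (latticePoint '' (G : Set N))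
  salient : ∀ σ ∈ cones, (σ : ConvexCone ℝ (RealSpan N)).Salient
  face_mem : ∀ σ ∈ cones, ∀ τ : PointedCone ℝ (RealSpan N), τ.IsFaceOf σ → τ ∈ cones
  inter_face : ∀ σ ∈ cones, ∀ τ ∈ cones, (σ ⊓ τ).IsFaceOf σ ∧ (σ ⊓ τ).IsFaceOf τ

namespace RationalFan

variable {N : Type*} [AddCommGroup N] (F : RationalFan N)

/-- The rays of a fan: its one-dimensional cones. -/
def rays : Set (PointedCone ℝ (RealSpan N)) := {ρ | ρ ∈ F.cones ∧ coneDim ρ = 1}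

/-- The support `|Σ|`, the union of all cones. -/
def support : Set (RealSpan N) := {x | ∃ σ ∈ F.cones, x ∈ σ}

/-- A fan is complete if its support is all of `N_ℝ`. -/
def IsComplete : Prop := F.support = Set.univ

end RationalFan

/-- A stacky fan: a rational simplicial fan `Σ` together with, for every ray `ρ`, a positive
integer multiple `b ρ` of the primitive lattice generator of `ρ`. -/
structure StackyFan (N : Type*) [AddCommGroup N] extends RationalFan N where
  simplicial : ∀ σ ∈ cones, σ.IsSimplicial
  b : toRationalFan.rays → N
  b_spec : ∀ ρ : toRationalFan.rays, ∃ v : N, IsPrimitive v ∧ latticePoint v ∈ ρ.1 ∧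
    ∃ a : ℕ, 0 < a ∧ b ρ = a • v

namespace StackyFan

section Psi

variable {N : Type*} [AddCommGroup N]

/-- `f` is linear on each cone of `Σ`, takes the value `1` at every `b ρ`, and (a normalization
only) vanishes off `|Σ|`. -/
structure IsPsi (S : StackyFan N) (f : RealSpan N → ℝ) : Prop where
  linear_on_cone : ∀ σ ∈ S.cones, ∃ l : RealSpan N →ₗ[ℝ] ℝ, ∀ x ∈ σ, f x = l x
  apply_b : ∀ ρ : S.rays, f (latticePoint (S.b ρ)) = 1
  apply_off_support : ∀ x, x ∉ S.support → f x = 0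

theorem latticePoint_ne_zero [Module.Free ℤ N] {v : N} (hv : v ≠ 0) : latticePoint v ≠ 0 := by
  intro h
  let B := Module.Free.chooseBasis ℤ N
  apply hv
  apply B.repr.injective
  ext i
  have h1 := congrArg (fun x => (Algebra.TensorProduct.basis ℝ B).repr x i) h
  simpa [latticePoint] using h1

theorem latticePoint_b_mem (S : StackyFan N) (ρ : S.rays) : latticePoint (S.b ρ) ∈ ρ.1 := by
  obtain ⟨v, -, hm, a, -, hb⟩ := S.b_spec ρ
  have : latticePoint (S.b ρ) = a • latticePoint v := by
    rw [hb]; simp [latticePoint, TensorProduct.tmul_smul]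
  rw [this]
  exact Submodule.smul_of_tower_mem _ a hm

theorem latticePoint_b_ne_zero [Module.Free ℤ N] (S : StackyFan N) (ρ : S.rays) :
    latticePoint (S.b ρ) ≠ 0 := by
  obtain ⟨v, hv, -, a, ha, hb⟩ := S.b_spec ρ
  have hv0 : v ≠ 0 := by
    rintro rfl
    have := hv 2 0 (by simp)
    omega
  have h2 : latticePoint (S.b ρ) = (a : ℝ) • latticePoint v := by
    rw [hb]; simp [latticePoint, TensorProduct.tmul_smul, Nat.cast_smul_eq_nsmul]
  rw [h2]
  exact smul_ne_zero (by exact_mod_cast ha.ne') (latticePoint_ne_zero hv0)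

section LinearAlgebra

variable {E : Type*} [AddCommGroup E] [Module ℝ E]

theorem exists_linearMap_eq {G : Set E} (hG : LinearIndepOn ℝ id G) (f : E → ℝ) :
    ∃ l : E →ₗ[ℝ] ℝ, ∀ g ∈ G, l g = f g := by
  refine ⟨(Module.Basis.extend hG).constr ℝ (fun i => f i), fun g hg => ?_⟩
  have h := (Module.Basis.extend hG).constr_basis ℝ (fun i => f i)
    ⟨g, hG.subset_extend (Set.subset_univ _) hg⟩
  simpa using h

theorem linearMap_eq_on_hull {G : Set E} {l l' : E →ₗ[ℝ] ℝ} (h : ∀ g ∈ G, l g = l' g)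
    {x : E} (hx : x ∈ PointedCone.hull ℝ G) : l x = l' x := by
  induction hx using Submodule.span_induction with
  | mem x hx => exact h x hx
  | zero => simp
  | add x y _ _ hx hy => simp [hx, hy]
  | smul a x _ hx =>
    have : a • x = (a : ℝ) • x := rfl
    rw [this, map_smul, map_smul, hx]

theorem linearMap_nonneg_on_hull {G : Set E} {l : E →ₗ[ℝ] ℝ} (h : ∀ g ∈ G, 0 ≤ l g)
    {x : E} (hx : x ∈ PointedCone.hull ℝ G) : 0 ≤ l x := by
  induction hx using Submodule.span_induction with
  | mem x hx => exact h x hx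
  | zero => simp
  | add x y _ _ hx hy => rw [map_add]; positivity
  | smul a x _ hx =>
    have : a • x = (a : ℝ) • x := rfl
    rw [this, map_smul]
    exact mul_nonneg a.2 hx

theorem mem_hull_singleton {g x : E} :
    x ∈ PointedCone.hull ℝ {g} ↔ ∃ c : ℝ, 0 ≤ c ∧ x = c • g := by
  rw [Submodule.mem_span_singleton]
  constructor
  · rintro ⟨c, rfl⟩
    exact ⟨c, c.2, rfl⟩
  · rintro ⟨c, hc, rfl⟩
    exact ⟨⟨c, hc⟩, rfl⟩

theorem hull_singleton_isFaceOf {G : Set E} (hG : LinearIndepOn ℝ id G) {g : E} (hg : g ∈ G) :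
    (PointedCone.hull ℝ {g}).IsFaceOf (PointedCone.hull ℝ G) := by
  classical
  refine ⟨Submodule.span_mono (by simpa using hg), ?_⟩
  intro x y a hx hy ha hxy
  -- the sum of all coordinates other than the one at `g`
  obtain ⟨l, hl⟩ := exists_linearMap_eq hG (fun g' => if g' = g then 0 else 1)
  have hpos : ∀ g' ∈ G, 0 ≤ l g' := by
    intro g' hg'
    rw [hl g' hg']
    split_ifs <;> norm_num
  have hx0 := linearMap_nonneg_on_hull hpos hx
  have hy0 := linearMap_nonneg_on_hull hpos hy
  obtain ⟨c, -, hc⟩ := mem_hull_singleton.1 hxy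
  have h0 : a * l x + l y = 0 := by
    have := congrArg l hc
    simpa [hl g hg] using this
  have hlx : l x = 0 := by nlinarith [mul_nonneg ha.le hx0]
  obtain ⟨c, hcG, hc0, rfl⟩ := PointedCone.mem_hull_set.1 hx
  refine Submodule.sum_mem _ fun g' hg' => ?_
  by_cases h : g' = g
  · subst h
    exact mem_hull_singleton.2 ⟨c g', hc0 _, rfl⟩
  · exfalso
    have hsum : ∑ i ∈ c.support, c i * l i = 0 := by
      simpa [Finsupp.sum, map_sum] using hlx
    have := (Finset.sum_eq_zero_iff_of_nonneg
      (fun i hi => mul_nonneg (hc0 i) (hpos i (hcG hi)))).1 hsum g' hg'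
    rw [hl g' (hcG hg'), if_neg h, mul_one] at this
    exact (Finsupp.mem_support_iff.1 hg') this

theorem span_hull_singleton (g : E) :
    Submodule.span ℝ ((PointedCone.hull ℝ {g} : PointedCone ℝ E) : Set E) =
      Submodule.span ℝ {g} := by
  apply le_antisymm
  · rw [Submodule.span_le]
    exact PointedCone.hull_le_span (R := ℝ) ({g} : Set E)
  · exact Submodule.span_mono Submodule.subset_span

end LinearAlgebra

theorem hull_singleton_mem_rays (S : StackyFan N) {G : Set (RealSpan N)}
    (hG : LinearIndepOn ℝ id G) (hσ : PointedCone.hull ℝ G ∈ S.cones) {g : RealSpan N}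
    (hg : g ∈ G) : PointedCone.hull ℝ {g} ∈ S.rays := by
  refine ⟨S.face_mem _ hσ _ (hull_singleton_isFaceOf hG hg), ?_⟩
  rw [coneDim, span_hull_singleton]
  have hg0 : g ≠ 0 := hG.ne_zero hg
  exact finrank_span_singleton (K := ℝ) hg0

theorem exists_eq_hull_singleton (S : StackyFan N) {G : Set (RealSpan N)}
    (hG : LinearIndepOn ℝ id G) (hσ : PointedCone.hull ℝ G ∈ S.cones)
    {ρ : PointedCone ℝ (RealSpan N)} (hρ : ρ ∈ S.rays) (hle : ρ ≤ PointedCone.hull ℝ G) :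
    ∃ g ∈ G, ρ = PointedCone.hull ℝ {g} := by
  have hface : ρ.IsFaceOf (PointedCone.hull ℝ G) := by
    have := (S.inter_face ρ hρ.1 _ hσ).2
    rwa [inf_eq_left.2 hle] at this
  have hdim := hρ.2
  -- a nonzero vector of the ray
  obtain ⟨x, hxρ, hx0⟩ : ∃ x ∈ ρ, x ≠ 0 := by
    by_contra! h
    have : Submodule.span ℝ (ρ : Set (RealSpan N)) = ⊥ := Submodule.span_eq_bot.2 h
    rw [coneDim, this] at hdim
    simp at hdim
  obtain ⟨c, hcG, hc0, hcx⟩ := PointedCone.mem_hull_set.1 (hle hxρ)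
  obtain ⟨g, hgc⟩ : c.support.Nonempty := by
    rw [Finset.nonempty_iff_ne_empty]
    intro h
    apply hx0
    rw [← hcx, Finsupp.sum, h, Finset.sum_empty]
  have hgG : g ∈ G := hcG hgc
  have hcg : 0 < c g := lt_of_le_of_ne (hc0 g) (Finsupp.mem_support_iff.1 hgc).symm
  have hgρ : g ∈ ρ := by
    classical
    refine hface.mem_of_smul_add_mem (y := ∑ i ∈ c.support.erase g, c i • i)
      (Submodule.subset_span hgG) ?_ hcg ?_
    · refine Submodule.sum_mem _ fun i hi => ?_
      exact PointedCone.smul_mem _ (hc0 i) (Submodule.subset_span (hcG (Finset.mem_of_mem_erase hi)))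
    · rw [Finset.add_sum_erase _ (fun i => c i • i) hgc]
      rw [Finsupp.sum] at hcx
      rw [hcx]
      exact hxρ
  have hg0 : g ≠ 0 := hG.ne_zero hgG
  refine ⟨g, hgG, le_antisymm ?_ ?_⟩
  · intro y hy
    have hg' : (⟨g, Submodule.subset_span hgρ⟩ :
        Submodule.span ℝ (ρ : Set (RealSpan N))) ≠ 0 := by
      simpa [Subtype.ext_iff] using hg0
    obtain ⟨a, ha⟩ := (finrank_eq_one_iff_of_nonzero' _ hg').1 hdim
      ⟨y, Submodule.subset_span hy⟩
    have ha' : a • g = y := congrArg Subtype.val ha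
    obtain ⟨l, hl⟩ := exists_linearMap_eq hG (fun _ => 1)
    have hly : 0 ≤ l y :=
      linearMap_nonneg_on_hull (fun g' hg' => by rw [hl g' hg']; norm_num) (hle hy)
    rw [← ha', map_smul, hl g hgG] at hly
    exact mem_hull_singleton.2 ⟨a, by simpa using hly, ha'.symm⟩
  · rw [Submodule.span_le]
    simpa using hgρ

variable [Module.Free ℤ N]

theorem exists_b_eq (S : StackyFan N) (ρ : S.rays) {g : RealSpan N}
    (h : ρ.1 = PointedCone.hull ℝ {g}) :
    ∃ c : ℝ, 0 < c ∧ latticePoint (S.b ρ) = c • g := by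
  have h1 := latticePoint_b_mem S ρ
  rw [h] at h1
  obtain ⟨c, hc, hb⟩ := mem_hull_singleton.1 h1
  refine ⟨c, lt_of_le_of_ne hc ?_, hb⟩
  rintro rfl
  exact latticePoint_b_ne_zero S ρ (by simpa using hb)

/-- On a cone there is a linear form with value `1` at each `b ρ`. -/
theorem exists_linearMap_b (S : StackyFan N) {σ : PointedCone ℝ (RealSpan N)} (hσ : σ ∈ S.cones) :
    ∃ l : RealSpan N →ₗ[ℝ] ℝ, ∀ ρ : S.rays, ρ.1 ≤ σ → l (latticePoint (S.b ρ)) = 1 := by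
  classical
  obtain ⟨G, -, hG, rfl⟩ := S.simplicial σ hσ
  have key : ∀ g : RealSpan N, ∃ e : ℝ, ∀ ρ : S.rays, ρ.1 = PointedCone.hull ℝ {g} →
      ∃ c : ℝ, 0 < c ∧ latticePoint (S.b ρ) = c • g ∧ e = c⁻¹ := by
    intro g
    by_cases h : ∃ ρ : S.rays, ρ.1 = PointedCone.hull ℝ {g}
    · obtain ⟨ρ, hρ⟩ := h
      obtain ⟨c, hc, hb⟩ := exists_b_eq S ρ hρ
      refine ⟨c⁻¹, fun ρ' hρ' => ⟨c, hc, ?_, rfl⟩⟩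
      obtain rfl : ρ = ρ' := Subtype.ext (hρ.trans hρ'.symm)
      exact hb
    · exact ⟨0, fun ρ hρ => (h ⟨ρ, hρ⟩).elim⟩
  choose e he using key
  obtain ⟨l, hl⟩ := exists_linearMap_eq hG e
  refine ⟨l, fun ρ hle => ?_⟩
  obtain ⟨g, hg, hρ⟩ := exists_eq_hull_singleton S hG hσ ρ.2 hle
  obtain ⟨c, hc, hb, hec⟩ := he g ρ hρ
  rw [hb, map_smul, hl g hg, hec, smul_eq_mul, mul_inv_cancel₀ hc.ne']

/-- A linear form on a cone is determined by its values at the `b ρ`. -/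
theorem linearMap_eq_of_b (S : StackyFan N) {σ : PointedCone ℝ (RealSpan N)} (hσ : σ ∈ S.cones)
    {l l' : RealSpan N →ₗ[ℝ] ℝ}
    (h : ∀ ρ : S.rays, ρ.1 ≤ σ → l (latticePoint (S.b ρ)) = l' (latticePoint (S.b ρ)))
    {x : RealSpan N} (hx : x ∈ σ) : l x = l' x := by
  obtain ⟨G, -, hG, rfl⟩ := S.simplicial σ hσ
  refine linearMap_eq_on_hull (fun g hg => ?_) hx
  have hray := hull_singleton_mem_rays S hG hσ hg
  obtain ⟨c, hc, hb⟩ := exists_b_eq S ⟨_, hray⟩ rfl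
  have h1 := h ⟨_, hray⟩ (Submodule.span_mono (by simpa using hg))
  rw [hb, map_smul, map_smul] at h1
  exact smul_right_injective ℝ hc.ne' h1

theorem exists_isPsi (S : StackyFan N) : ∃ f, S.IsPsi f := by
  classical
  choose l hl using fun σ : S.cones => exists_linearMap_b S σ.2
  have compat : ∀ (σ τ : S.cones) (x : RealSpan N), x ∈ σ.1 → x ∈ τ.1 → l σ x = l τ x := by
    intro σ τ x hxσ hxτ
    have hmem : σ.1 ⊓ τ.1 ∈ S.cones := S.face_mem _ σ.2 _ (S.inter_face _ σ.2 _ τ.2).1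
    refine linearMap_eq_of_b S hmem (fun ρ hρ => ?_) ⟨hxσ, hxτ⟩
    rw [hl σ ρ (hρ.trans inf_le_left), hl τ ρ (hρ.trans inf_le_right)]
  let f : RealSpan N → ℝ := fun x =>
    if h : ∃ σ : S.cones, x ∈ σ.1 then l h.choose x else 0
  have hf : ∀ (σ : S.cones) (x : RealSpan N), x ∈ σ.1 → f x = l σ x := by
    intro σ x hx
    have h : ∃ σ : S.cones, x ∈ σ.1 := ⟨σ, hx⟩
    simp only [f, dif_pos h]
    exact compat _ _ _ h.choose_spec hx
  refine ⟨f, fun σ hσ => ⟨l ⟨σ, hσ⟩, hf ⟨σ, hσ⟩⟩, fun ρ => ?_, fun x hx => ?_⟩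
  · rw [hf ⟨ρ.1, ρ.2.1⟩ _ (latticePoint_b_mem S ρ)]
    exact hl ⟨ρ.1, ρ.2.1⟩ ρ le_rfl
  · refine dif_neg ?_
    rintro ⟨σ, hσ⟩
    exact hx ⟨σ.1, σ.2, hσ⟩

theorem IsPsi.unique {S : StackyFan N} {f g : RealSpan N → ℝ} (hf : S.IsPsi f) (hg : S.IsPsi g) :
    f = g := by
  funext x
  by_cases hx : x ∈ S.support
  · obtain ⟨σ, hσ, hx⟩ := hx
    obtain ⟨l, hl⟩ := hf.linear_on_cone σ hσ
    obtain ⟨l', hl'⟩ := hg.linear_on_cone σ hσ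
    rw [hl x hx, hl' x hx]
    refine linearMap_eq_of_b S hσ (fun ρ hρ => ?_) hx
    have hb := hρ (latticePoint_b_mem S ρ)
    rw [← hl _ hb, ← hl' _ hb, hf.apply_b, hg.apply_b]
  · rw [hf.apply_off_support x hx, hg.apply_off_support x hx]

/-- The piecewise linear function `ψ` on `|Σ|` that is linear on each cone and satisfies
`ψ (b ρ) = 1` for every ray `ρ` (extended by `0` off `|Σ|`). It exists and is unique. -/
noncomputable def psi (S : StackyFan N) : RealSpan N → ℝ := Classical.choose S.exists_isPsi

theorem isPsi_psi (S : StackyFan N) : S.IsPsi S.psi := Classical.choose_spec S.exists_isPsi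

end Psi

variable {N : Type*} [AddCommGroup N] [Module.Free ℤ N]

/-- `Q = {v ∈ |Σ| : ψ(v) ≤ 1}`. -/
def Q (S : StackyFan N) : Set (RealSpan N) := {x | x ∈ S.support ∧ S.psi x ≤ 1}

/-- The weight `w₀(v) = ψ(v) - ⌈ψ(v)⌉` of a lattice point `v` of `|Σ|`. -/
noncomputable def weight (S : StackyFan N) (v : N) : ℝ :=
  S.psi (latticePoint v) - ⌈S.psi (latticePoint v)⌉

/-- `f⁰ₖ(m)`: the number of lattice points of weight `k` in `mQ`. -/
noncomputable def count (S : StackyFan N) (k : ℚ) (m : ℕ) : ℕ :=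
  {v : N | latticePoint v ∈ (m : ℝ) • S.Q ∧ S.weight v = (k : ℝ)}.ncard

/-- The power series `δ⁰ₖ(t) = (1 - t)^(d+1) ∑_{m ≥ 0} f⁰ₖ(m) t^m`, where `d` is the rank of `N`. -/
noncomputable def deltaSeries (S : StackyFan N) (k : ℚ) : PowerSeries ℤ :=
  (1 - PowerSeries.X) ^ (Module.finrank ℤ N + 1) * PowerSeries.mk fun m => (S.count k m : ℤ)

end StackyFan

/-- Polynomials (with positive and negative exponents) with integer coefficients in
rational powers of `t`. -/
abbrev FracPoly : Type := AddMonoidAlgebra ℤ ℚ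

namespace FracPoly

/-- The monomial `t^q`. -/
noncomputable def T (q : ℚ) : FracPoly := AddMonoidAlgebra.single q 1

/-- A polynomial in `t`, regarded as a polynomial in rational powers of `t`. -/
noncomputable def ofPolynomial : Polynomial ℤ →ₐ[ℤ] FracPoly := Polynomial.aeval (T 1)

/-- The substitution `t ↦ t⁻¹`. -/
noncomputable def invert : FracPoly ≃ₐ[ℤ] FracPoly :=
  AddMonoidAlgebra.domCongr ℤ ℤ (AddEquiv.neg ℚ)

/-- `∑_{k ∈ ℚ} δₖ(t) t^k`, for a family of polynomials `δₖ` with only finitely many nonzero members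
(it is used only for such families). -/
noncomputable def weightedSum (δ : ℚ → Polynomial ℤ) : FracPoly :=
  ∑ᶠ k : ℚ, ofPolynomial (δ k) * T k

end FracPoly

end WeightedEhrhart

namespace WeightedEhrhart

open Module

/-! ### Additivity of the embedding of the lattice in `RealSpan N`. -/

section Lattice

variable {N : Type*} [AddCommGroup N]

/-! Fix a vector `ξ` outside finitely many proper subspaces. For every point `x`, the points `x + ε
• ξ` with small `ε > 0` lie in the interior of exactly one maximal cone. Assigning `x` to that cone
partitions the space into half-open simplicial cones: in each one, the facets opposite to the
generators with negative `ξ`-coordinate are removed (`IsGeneric.exists_mem_halfOpen`,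
`IsGeneric.halfOpen_unique`).

In a half-open cone with generators `b₁, …, b_d`, each lattice point is uniquely a point of a
half-open parallelepiped (a box) plus a natural combination of the `bᵢ`. Since `ψ` is the coordinate
sum there, adding `bᵢ` raises it by 1 and keeps the weight. A box point `p` thus contributes
`t^⌈ψ(p)⌉ / (1 - t)^(d+1)` to the counting series (`cone_count`, `boxPoly_coe`), so `δ⁰ₖ` is the sum
of `t^⌈ψ(p)⌉` over all box points of weight `k` (`IsGeneric.boxSum_coe`). In particular this sum
does not depend on `ξ`.

The symmetries come from `v ↦ ∑ bᵢ - v`, which exchanges the boxes for `ξ` with those for `-ξ` and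
sends `ψ` to `d - ψ`; independence of `ξ` identifies the two sums. On weight 0 the ceiling `c`
becomes `d - c`; on weight `k` in `(-1, 0)` the new weight is `-1 - k` and the ceiling becomes `d +
1 - c`. For positivity of the `i`-th coefficient, choose `ξ` so that some cone has exactly `i`
removed facets: the sum of the corresponding `bⱼ` is a box point of height `i`. -/

theorem latticePoint_add (v w : N) :
    latticePoint (v + w) = latticePoint v + latticePoint w := TensorProduct.tmul_add _ _ _

theorem latticePoint_sub (v w : N) :
    latticePoint (v - w) = latticePoint v - latticePoint w := TensorProduct.tmul_sub _ _ _

theorem latticePoint_nsmul (n : ℕ) (v : N) :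
    latticePoint (n • v) = (n : ℝ) • latticePoint v := by
  simp [latticePoint, TensorProduct.tmul_smul, Nat.cast_smul_eq_nsmul]

theorem latticePoint_sum {ι : Type*} (s : Finset ι) (f : ι → N) :
    latticePoint (∑ i ∈ s, f i) = ∑ i ∈ s, latticePoint (f i) := TensorProduct.tmul_sum _ _ _

end Lattice

/-! ### Half-open simplicial cones and their parallelepipeds. -/

/-- A basis of `N_ℝ` consisting of lattice vectors. -/
structure LatticeFrame (N : Type*) [AddCommGroup N] where
  vec : Fin (finrank ℤ N) → N
  basis : Basis (Fin (finrank ℤ N)) ℝ (RealSpan N)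
  basis_apply : ∀ i, basis i = latticePoint (vec i)

namespace LatticeFrame

variable {N : Type*} [AddCommGroup N] (F : LatticeFrame N)

/-- The coordinates of a lattice vector. -/
noncomputable def coord (v : N) (i : Fin (finrank ℤ N)) : ℝ := F.basis.repr (latticePoint v) i

/-- The sum of the coordinates of a lattice vector. -/
noncomputable def height (v : N) : ℝ := ∑ i, F.coord v i

theorem coord_add (v w : N) (i) : F.coord (v + w) i = F.coord v i + F.coord w i := by
  simp [coord, latticePoint_add]

theorem coord_sub (v w : N) (i) : F.coord (v - w) i = F.coord v i - F.coord w i := by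
  simp [coord, latticePoint_sub]

theorem coord_sum_nsmul (n : Fin (finrank ℤ N) → ℕ) (i) :
    F.coord (∑ j, n j • F.vec j) i = n i := by
  simp [coord, latticePoint_sum, latticePoint_nsmul, ← F.basis_apply, Finsupp.single_apply]

theorem coord_sum_vec (i) : F.coord (∑ j, F.vec j) i = 1 := by
  simpa using F.coord_sum_nsmul (fun _ => 1) i

theorem height_add (v w : N) : F.height (v + w) = F.height v + F.height w := by
  simp [height, coord_add, Finset.sum_add_distrib]

theorem height_sub (v w : N) : F.height (v - w) = F.height v - F.height w := by
  simp [height, coord_sub, Finset.sum_sub_distrib]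

theorem height_sum_vec : F.height (∑ j, F.vec j) = finrank ℤ N := by
  simp [height, coord_sum_vec]

theorem height_sum_nsmul (n : Fin (finrank ℤ N) → ℕ) :
    F.height (∑ j, n j • F.vec j) = (∑ j, n j : ℕ) := by
  simp [height, coord_sum_nsmul]

/-- The lattice points of the half-open cone spanned by a frame, with the facets opposite to the
elements of `I` removed. -/
def halfOpenCone (I : Finset (Fin (finrank ℤ N))) : Set N :=
  {v | ∀ i, 0 ≤ F.coord v i ∧ (i ∈ I → 0 < F.coord v i)}

/-- The lattice points of the half-open parallelepiped that generates `halfOpenCone`. -/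
def halfOpenBox (I : Finset (Fin (finrank ℤ N))) : Set N :=
  {v | ∀ i, 0 ≤ F.coord v i ∧ F.coord v i ≤ 1 ∧ (i ∈ I → 0 < F.coord v i) ∧
    (i ∉ I → F.coord v i < 1)}

theorem halfOpenBox_subset (I) : F.halfOpenBox I ⊆ F.halfOpenCone I :=
  fun _ hv i => ⟨(hv i).1, (hv i).2.2.1⟩

theorem height_nonneg {I} {v : N} (hv : v ∈ F.halfOpenCone I) : 0 ≤ F.height v :=
  Finset.sum_nonneg fun i _ => (hv i).1

theorem height_le {I} {v : N} (hv : v ∈ F.halfOpenBox I) : F.height v ≤ finrank ℤ N := by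
  have : F.height v ≤ ∑ _i : Fin (finrank ℤ N), (1 : ℝ) :=
    Finset.sum_le_sum fun i _ => (hv i).2.1
  simpa using this

/-- The map `c ↦ 1 - c` exchanges the intervals `(0, 1]` and `[0, 1)`, hence the complement of `I`.
-/
theorem sum_vec_sub_mem {I} {v : N} (hv : v ∈ F.halfOpenBox I) :
    ∑ j, F.vec j - v ∈ F.halfOpenBox Iᶜ := by
  intro i
  have h := hv i
  simp only [coord_sub, coord_sum_vec, Finset.mem_compl, not_not]
  refine ⟨by linarith, by linarith, fun hi => ?_, fun hi => ?_⟩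
  · linarith [h.2.2.2 hi]
  · linarith [h.2.2.1 hi]

theorem sum_vec_mem (I : Finset (Fin (finrank ℤ N))) : ∑ j ∈ I, F.vec j ∈ F.halfOpenBox I := by
  classical
  intro i
  have h : F.coord (∑ j ∈ I, F.vec j) i = if i ∈ I then 1 else 0 := by
    have := F.coord_sum_nsmul (fun j => if j ∈ I then 1 else 0) i
    simpa using this
  rw [h]
  split_ifs with hi <;> simp [hi]

theorem height_sum_vec_mem (I : Finset (Fin (finrank ℤ N))) :
    F.height (∑ j ∈ I, F.vec j) = I.card := by
  classical
  have := F.height_sum_nsmul (fun j => if j ∈ I then 1 else 0)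
  simpa using this

theorem halfOpenBox_finite [Module.Free ℤ N] [Module.Finite ℤ N] (I) :
    (F.halfOpenBox I).Finite := by
  let e := Module.Free.chooseBasis ℤ N
  let eR := Algebra.TensorProduct.basis ℝ e
  -- Frame coordinates of box points lie in `[0, 1]`, so this bounds their integral coordinates in a
  -- lattice basis.
  let M : Module.Free.ChooseBasisIndex ℤ N → ℤ := fun a => ⌈∑ i, |eR.repr (F.basis i) a|⌉
  have hsub : (fun v a => e.repr v a) '' F.halfOpenBox I ⊆ Set.Icc (-M) M := by
    rintro _ ⟨v, hv, rfl⟩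
    have key : ∀ a, |((e.repr v a : ℤ) : ℝ)| ≤ M a := by
      intro a
      have h1 : ((e.repr v a : ℤ) : ℝ) = ∑ i, F.coord v i * eR.repr (F.basis i) a := by
        have h2 : eR.repr (latticePoint v) a = ((e.repr v a : ℤ) : ℝ) := by
          simp [eR, latticePoint]
        rw [← h2]
        have h3 := congrArg (fun x => eR.repr x a) (F.basis.sum_repr (latticePoint v))
        simpa [coord, -Basis.sum_repr] using h3.symm
      rw [h1]
      refine (Finset.abs_sum_le_sum_abs _ _).trans ((Finset.sum_le_sum fun i _ => ?_).trans
        (Int.le_ceil _))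
      rw [abs_mul, abs_of_nonneg (hv i).1]
      exact mul_le_of_le_one_left (abs_nonneg _) (hv i).2.1
    refine ⟨fun a => ?_, fun a => ?_⟩
    · have := (abs_le.1 (key a)).1
      exact_mod_cast this
    · have := (abs_le.1 (key a)).2
      exact_mod_cast this
  refine Set.Finite.of_finite_image ((Set.finite_Icc _ _).subset hsub) ?_
  intro v _ w _ h
  apply e.repr.injective
  ext a
  exact congrFun h a

theorem exists_box_add {I} {v : N} (hv : v ∈ F.halfOpenCone I) :
    ∃ p ∈ F.halfOpenBox I, ∃ n : Fin (finrank ℤ N) → ℕ, v = p + ∑ j, n j • F.vec j := by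
  have key : ∀ i, ∃ n : ℕ, 0 ≤ F.coord v i - n ∧ F.coord v i - n ≤ 1 ∧
      (i ∈ I → 0 < F.coord v i - n) ∧ (i ∉ I → F.coord v i - n < 1) := by
    intro i
    by_cases hi : i ∈ I
    · have hpos := (hv i).2 hi
      -- For `i ∈ I` the remainder must lie in `(0, 1]`, so `⌈c⌉ - 1` is subtracted; otherwise it
      -- must lie in `[0, 1)` and `⌊c⌋` is subtracted.
      obtain ⟨n, hn⟩ : ∃ n : ℕ, (⌈F.coord v i⌉ : ℤ) = n + 1 :=
        ⟨(⌈F.coord v i⌉ - 1).toNat, by have := Int.ceil_pos.2 hpos; omega⟩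
      have h1 := Int.le_ceil (F.coord v i)
      have h2 := Int.ceil_lt_add_one (F.coord v i)
      rw [hn] at h1 h2
      push_cast at h1 h2
      exact ⟨n, by linarith, by linarith, fun _ => by linarith, fun h => (h hi).elim⟩
    · have h1 := Nat.floor_le (hv i).1
      have h2 := Nat.lt_floor_add_one (F.coord v i)
      exact ⟨⌊F.coord v i⌋₊, by linarith, by linarith, fun h => (hi h).elim, fun _ => by linarith⟩
  choose n hn using key
  refine ⟨v - ∑ j, n j • F.vec j, fun i => ?_, n, by abel⟩
  rw [coord_sub, coord_sum_nsmul]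
  exact hn i

theorem box_add_mem {I} {p : N} (hp : p ∈ F.halfOpenBox I) (n : Fin (finrank ℤ N) → ℕ) :
    p + ∑ j, n j • F.vec j ∈ F.halfOpenCone I := by
  intro i
  rw [coord_add, coord_sum_nsmul]
  exact ⟨add_nonneg (hp i).1 (by positivity),
    fun hi => add_pos_of_pos_of_nonneg ((hp i).2.2.1 hi) (by positivity)⟩

theorem box_add_injective {I} {p q : N} (hp : p ∈ F.halfOpenBox I)
    (hq : q ∈ F.halfOpenBox I) {n m : Fin (finrank ℤ N) → ℕ}
    (h : p + ∑ j, n j • F.vec j = q + ∑ j, m j • F.vec j) : p = q ∧ n = m := by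
  have hnm : n = m := by
    funext i
    have h1 := congrArg (fun v => F.coord v i) h
    simp only [coord_add, coord_sum_nsmul] at h1
    have hlt : |(n i : ℝ) - m i| < 1 := by
      rw [abs_lt]
      have hp := hp i
      have hq := hq i
      by_cases hi : i ∈ I
      · have := hp.2.2.1 hi
        have := hq.2.2.1 hi
        constructor <;> linarith
      · have := hp.2.2.2 hi
        have := hq.2.2.2 hi
        constructor <;> linarith
    have : |(n i : ℤ) - m i| < 1 := by exact_mod_cast hlt
    have := Int.abs_lt_one_iff.1 this
    omega
  subst hnm
  exact ⟨add_right_cancel h, rfl⟩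

variable [Module.Free ℤ N] [Module.Finite ℤ N]

open Classical in
/-- The lattice points of weight `k` in the half-open parallelepiped. -/
noncomputable def boxPoints (I : Finset (Fin (finrank ℤ N))) (k : ℚ) : Finset N :=
  (F.halfOpenBox_finite I).toFinset.filter fun v => F.height v - ⌈F.height v⌉ = (k : ℝ)

theorem mem_boxPoints {I} {k : ℚ} {v : N} : v ∈ F.boxPoints I k ↔
    v ∈ F.halfOpenBox I ∧ F.height v - ⌈F.height v⌉ = (k : ℝ) := by
  simp [boxPoints]

-- Above a box point `p` the admissible multiplicities are the `n` with `∑ n j ≤ m - ⌈F.height p⌉₊`.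
-- A slack variable, indexed by `none`, turns this into an equation in `d + 1` unknowns, counted by
-- stars and bars.
open Classical in
theorem cone_count (I) (k : ℚ) (m : ℕ) :
    {v | v ∈ F.halfOpenCone I ∧ ⌈F.height v⌉₊ ≤ m ∧
      F.height v - ⌈F.height v⌉ = (k : ℝ)}.Finite ∧
    {v | v ∈ F.halfOpenCone I ∧ ⌈F.height v⌉₊ ≤ m ∧
      F.height v - ⌈F.height v⌉ = (k : ℝ)}.ncard =
    ∑ p ∈ F.boxPoints I k, if ⌈F.height p⌉₊ ≤ m then
      (finrank ℤ N + (m - ⌈F.height p⌉₊)).choose (finrank ℤ N) else 0 := by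
  let T : Finset (Σ _ : N, Option (Fin (finrank ℤ N)) →₀ ℕ) :=
    (F.boxPoints I k).sigma fun p => if ⌈F.height p⌉₊ ≤ m then
      Finset.finsuppAntidiag Finset.univ (m - ⌈F.height p⌉₊) else ∅
  let φ : (Σ _ : N, Option (Fin (finrank ℤ N)) →₀ ℕ) → N :=
    fun x => x.1 + ∑ j, x.2 (some j) • F.vec j
  have hT : ∀ x, x ∈ T ↔ x.1 ∈ F.boxPoints I k ∧ ⌈F.height x.1⌉₊ ≤ m ∧
      x.2 none + ∑ j, x.2 (some j) = m - ⌈F.height x.1⌉₊ := by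
    intro x
    simp only [T, Finset.mem_sigma]
    split_ifs with h <;> simp [h]
  have hφ : ∀ (p : N) (n : Fin (finrank ℤ N) → ℕ), p ∈ F.halfOpenBox I →
      (⌈F.height (p + ∑ j, n j • F.vec j)⌉₊ = ⌈F.height p⌉₊ + ∑ j, n j) ∧
      F.height (p + ∑ j, n j • F.vec j) - ⌈F.height (p + ∑ j, n j • F.vec j)⌉ =
        F.height p - ⌈F.height p⌉ := by
    intro p n hp
    rw [height_add, height_sum_nsmul]
    refine ⟨Nat.ceil_add_natCast (F.height_nonneg (F.halfOpenBox_subset I hp)) _, ?_⟩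
    rw [Int.ceil_add_natCast]
    push_cast
    ring
  have himage : {v | v ∈ F.halfOpenCone I ∧ ⌈F.height v⌉₊ ≤ m ∧
      F.height v - ⌈F.height v⌉ = (k : ℝ)} = ((T.image φ : Finset N) : Set N) := by
    ext v
    simp only [Set.mem_ofPred_eq, Finset.coe_image, Set.mem_image, Finset.mem_coe, hT,
      mem_boxPoints]
    constructor
    · rintro ⟨hv, hm, hk⟩
      obtain ⟨p, hp, n, rfl⟩ := F.exists_box_add hv
      obtain ⟨h1, h2⟩ := hφ p n hp
      rw [h1] at hm
      rw [h2] at hk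
      refine ⟨⟨p, Finsupp.equivFunOnFinite.symm
        (fun o => o.elim (m - (⌈F.height p⌉₊ + ∑ j, n j)) n)⟩, ⟨⟨hp, hk⟩, by dsimp only; omega, ?_⟩, ?_⟩
      · simp only [Finsupp.equivFunOnFinite_symm_apply_apply, Option.elim]
        omega
      · simp [φ]
    · rintro ⟨⟨p, g⟩, ⟨⟨hp, hk⟩, hm, hg⟩, rfl⟩
      obtain ⟨h1, h2⟩ := hφ p (fun j => g (some j)) hp
      dsimp only at hg hm hk
      refine ⟨F.box_add_mem hp _, ?_, ?_⟩
      · simp only [φ]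
        rw [h1]
        omega
      · simp only [φ]
        rw [h2, hk]
  have hinj : Set.InjOn φ T := by
    rintro ⟨p, g⟩ hx ⟨q, g'⟩ hy h
    simp only [Finset.mem_coe, hT, mem_boxPoints] at hx hy
    obtain ⟨rfl, hg⟩ := F.box_add_injective hx.1.1 hy.1.1 h
    congr 1
    ext o
    cases o with
    | some j => exact congrFun hg j
    | none =>
      have h3 : ∑ j, g (some j) = ∑ j, g' (some j) := by
        exact Finset.sum_congr rfl fun j _ => congrFun hg j
      have h1 := hx.2.2
      have h2 := hy.2.2
      omega
  rw [himage]
  refine ⟨Finset.finite_toSet _, ?_⟩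
  rw [Set.ncard_coe_finset, Finset.card_image_of_injOn hinj, Finset.card_sigma]
  refine Finset.sum_congr rfl fun p _ => ?_
  split_ifs with h
  · rw [Finset.card_finsuppAntidiag_nat_eq_choose]
    simp only [Finset.card_univ, Fintype.card_option, Fintype.card_fin]
    rw [show finrank ℤ N + 1 + (m - ⌈F.height p⌉₊) - 1 = finrank ℤ N + (m - ⌈F.height p⌉₊) by omega]
    exact Nat.choose_symm_of_eq_add (by omega)
  · simp

/-- The generating polynomial of the lattice points of weight `k` in the half-open
parallelepiped. -/
noncomputable def boxPoly (I : Finset (Fin (finrank ℤ N))) (k : ℚ) : Polynomial ℤ :=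
  ∑ p ∈ F.boxPoints I k, Polynomial.X ^ ⌈F.height p⌉₊

/-- The binomials of `cone_count` are the coefficients of `1 / (1 - t)^(d+1)`, shifted by `⌈F.height
p⌉₊` for each box point `p`. -/
theorem boxPoly_coe (I) (k : ℚ) :
    (F.boxPoly I k : PowerSeries ℤ) = (1 - PowerSeries.X) ^ (finrank ℤ N + 1) *
      PowerSeries.mk fun m => (({v | v ∈ F.halfOpenCone I ∧ ⌈F.height v⌉₊ ≤ m ∧
        F.height v - ⌈F.height v⌉ = (k : ℝ)}.ncard : ℕ) : ℤ) := by
  have h1 : (PowerSeries.mk fun m => (({v | v ∈ F.halfOpenCone I ∧ ⌈F.height v⌉₊ ≤ m ∧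
        F.height v - ⌈F.height v⌉ = (k : ℝ)}.ncard : ℕ) : ℤ)) =
      (F.boxPoly I k : PowerSeries ℤ) *
        PowerSeries.mk fun n => ((finrank ℤ N + n).choose (finrank ℤ N) : ℤ) := by
    ext m
    rw [PowerSeries.coeff_mk, (F.cone_count I k m).2, boxPoly]
    rw [← Polynomial.coeToPowerSeries.ringHom_apply, map_sum, Finset.sum_mul, map_sum]
    push_cast
    refine Finset.sum_congr rfl fun p _ => ?_
    rw [map_pow, Polynomial.coeToPowerSeries.ringHom_apply, Polynomial.coe_X,
      PowerSeries.coeff_X_pow_mul']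
    simp
  rw [h1, mul_comm, mul_assoc, PowerSeries.mk_add_choose_mul_one_sub_pow_eq_one, mul_one]

theorem boxPoints_eq_empty (I) {k : ℚ} (hk : ¬ (-1 < k ∧ k ≤ 0)) : F.boxPoints I k = ∅ := by
  rw [Finset.eq_empty_iff_forall_notMem]
  intro v hv
  apply hk
  have h := (F.mem_boxPoints.1 hv).2
  have h1 := Int.le_ceil (F.height v)
  have h2 := Int.ceil_lt_add_one (F.height v)
  constructor
  · have : (-1 : ℝ) < (k : ℝ) := by linarith
    exact_mod_cast this
  · have : (k : ℝ) ≤ 0 := by linarith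
    exact_mod_cast this

theorem setOf_boxPoints_nonempty_finite (I) : {k | F.boxPoints I k ≠ ∅}.Finite := by
  have : {k | F.boxPoints I k ≠ ∅} ⊆ (fun k : ℚ => (k : ℝ)) ⁻¹'
      ((fun v => F.height v - ⌈F.height v⌉) '' F.halfOpenBox I) := by
    intro k hk
    obtain ⟨v, hv⟩ := Finset.nonempty_iff_ne_empty.2 hk
    exact ⟨v, F.mem_boxPoints.1 hv⟩
  exact (((F.halfOpenBox_finite I).image _).preimage (Rat.cast_injective.injOn)).subset this

/-- A point of height 0 has weight 0. This is the source of the factor `t` in `δ⁰ₖ` for `k ≠ 0`. -/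
theorem one_le_ceil {I} {k : ℚ} (hk : k ≠ 0) {v : N} (hv : v ∈ F.boxPoints I k) :
    1 ≤ ⌈F.height v⌉₊ := by
  obtain ⟨hb, hw⟩ := F.mem_boxPoints.1 hv
  have h0 := F.height_nonneg (F.halfOpenBox_subset I hb)
  rw [Nat.one_le_ceil_iff]
  refine lt_of_le_of_ne h0 fun h => hk ?_
  rw [← h] at hw
  simp at hw
  exact_mod_cast hw.symm

theorem ceil_le {I} {k : ℚ} {v : N} (hv : v ∈ F.boxPoints I k) :
    ⌈F.height v⌉₊ ≤ finrank ℤ N :=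
  Nat.ceil_le.2 (F.height_le (F.mem_boxPoints.1 hv).1)

theorem boxPoly_natDegree_le (I) (k : ℚ) : (F.boxPoly I k).natDegree ≤ finrank ℤ N :=
  Polynomial.natDegree_sum_le_of_forall_le _ _ fun p hp => by
    rw [Polynomial.natDegree_X_pow]
    exact F.ceil_le hp

theorem boxPoly_coeff (I) (k : ℚ) (n : ℕ) :
    (F.boxPoly I k).coeff n = ∑ p ∈ F.boxPoints I k, if n = ⌈F.height p⌉₊ then 1 else 0 := by
  simp [boxPoly, Polynomial.coeff_X_pow]

theorem boxPoly_coeff_nonneg (I) (k : ℚ) (n : ℕ) : 0 ≤ (F.boxPoly I k).coeff n := by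
  rw [boxPoly_coeff]
  exact Finset.sum_nonneg fun p _ => by split_ifs <;> norm_num

theorem boxPoly_coeff_card_pos (I) : 0 < (F.boxPoly I 0).coeff I.card := by
  rw [boxPoly_coeff]
  refine Finset.sum_pos' (fun p _ => by split_ifs <;> norm_num) ⟨∑ j ∈ I, F.vec j, ?_, ?_⟩
  · rw [mem_boxPoints, height_sum_vec_mem]
    exact ⟨F.sum_vec_mem I, by simp⟩
  · rw [height_sum_vec_mem]
    simp

/-! ### Reflection of the box polynomials. -/

theorem ceil_cast {I} {k : ℚ} {v : N} (hv : v ∈ F.boxPoints I k) :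
    (⌈F.height v⌉₊ : ℤ) = ⌈F.height v⌉ :=
  Int.natCast_ceil_eq_ceil (F.height_nonneg (F.halfOpenBox_subset I (F.mem_boxPoints.1 hv).1))

theorem toLaurent_boxPoly (I) (k : ℚ) : Polynomial.toLaurent (F.boxPoly I k) =
    ∑ p ∈ F.boxPoints I k, LaurentPolynomial.T ⌈F.height p⌉ := by
  rw [boxPoly, map_sum]
  refine Finset.sum_congr rfl fun p hp => ?_
  rw [Polynomial.toLaurent_X_pow, F.ceil_cast hp]

/-- If `v ↦ ∑ bᵢ - v` carries weight `k` to weight `k'` and `⌈·⌉` to `e - ⌈·⌉`, the generating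
polynomials correspond. -/
theorem toLaurent_boxPoly_of_reflect (I) {k k' : ℚ} {e : ℤ}
    (h : ∀ J, ∀ v ∈ F.boxPoints J k,
      (finrank ℤ N - F.height v) - ⌈finrank ℤ N - F.height v⌉ = (k' : ℝ) ∧
      ⌈finrank ℤ N - F.height v⌉ = e - ⌈F.height v⌉)
    (h' : ∀ J, ∀ v ∈ F.boxPoints J k',
      (finrank ℤ N - F.height v) - ⌈finrank ℤ N - F.height v⌉ = (k : ℝ)) :
    Polynomial.toLaurent (F.boxPoly I k) = LaurentPolynomial.T e *
      LaurentPolynomial.invert (Polynomial.toLaurent (F.boxPoly Iᶜ k')) := by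
  rw [toLaurent_boxPoly, toLaurent_boxPoly, map_sum, Finset.mul_sum]
  refine Finset.sum_bij' (fun v _ => ∑ j, F.vec j - v) (fun v _ => ∑ j, F.vec j - v)
    ?_ ?_ (fun v _ => by abel) (fun v _ => by abel) ?_
  · intro v hv
    rw [mem_boxPoints, height_sub, height_sum_vec]
    exact ⟨F.sum_vec_sub_mem (F.mem_boxPoints.1 hv).1, (h I v hv).1⟩
  · intro v hv
    rw [mem_boxPoints, height_sub, height_sum_vec]
    have := F.sum_vec_sub_mem (F.mem_boxPoints.1 hv).1
    rw [compl_compl] at this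
    exact ⟨this, h' _ v hv⟩
  · intro v hv
    rw [height_sub, height_sum_vec, (h I v hv).2, LaurentPolynomial.invert_T,
      ← LaurentPolynomial.T_add]
    congr 1
    ring

theorem toLaurent_boxPoly_zero (I) : Polynomial.toLaurent (F.boxPoly I 0) =
    LaurentPolynomial.T (finrank ℤ N) *
      LaurentPolynomial.invert (Polynomial.toLaurent (F.boxPoly Iᶜ 0)) := by
  have key : ∀ J, ∀ v ∈ F.boxPoints J 0,
      (finrank ℤ N - F.height v) - ⌈finrank ℤ N - F.height v⌉ = ((0 : ℚ) : ℝ) ∧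
      ⌈finrank ℤ N - F.height v⌉ = (finrank ℤ N : ℤ) - ⌈F.height v⌉ := by
    intro J v hv
    have hw := (F.mem_boxPoints.1 hv).2
    have hh : F.height v = ⌈F.height v⌉ := by
      rw [Rat.cast_zero] at hw
      linarith
    have h2 : ⌈(finrank ℤ N : ℝ) - F.height v⌉ = (finrank ℤ N : ℤ) - ⌈F.height v⌉ := by
      conv_lhs => rw [hh]
      rw [← Int.cast_natCast (finrank ℤ N), ← Int.cast_sub, Int.ceil_intCast]
    refine ⟨?_, h2⟩
    rw [h2]
    push_cast
    linarith
  exact F.toLaurent_boxPoly_of_reflect I key fun J v hv => (key J v hv).1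

theorem toLaurent_boxPoly_neg (I) {k : ℚ} (h1 : -1 < k) (h0 : k < 0) :
    Polynomial.toLaurent (F.boxPoly I k) = LaurentPolynomial.T ((finrank ℤ N : ℤ) + 1) *
      LaurentPolynomial.invert (Polynomial.toLaurent (F.boxPoly Iᶜ (-1 - k))) := by
  -- Here the height is not an integer, whence the extra 1 in the reflected ceiling. The claim
  -- quantifies over `k` again because the inverse map needs it at `-1 - k`.
  have key : ∀ k : ℚ, -1 < k → k < 0 → ∀ J, ∀ v ∈ F.boxPoints J k,
      (finrank ℤ N - F.height v) - ⌈finrank ℤ N - F.height v⌉ = ((-1 - k : ℚ) : ℝ) ∧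
      ⌈finrank ℤ N - F.height v⌉ = (finrank ℤ N : ℤ) + 1 - ⌈F.height v⌉ := by
    intro k h1 h0 J v hv
    have hw := (F.mem_boxPoints.1 hv).2
    have h1' : (-1 : ℝ) < k := by exact_mod_cast h1
    have h0' : (k : ℝ) < 0 := by exact_mod_cast h0
    have h2 : ⌈(finrank ℤ N : ℝ) - F.height v⌉ = (finrank ℤ N : ℤ) + 1 - ⌈F.height v⌉ := by
      rw [Int.ceil_eq_iff]
      push_cast
      constructor <;> linarith
    refine ⟨?_, h2⟩
    rw [h2]
    push_cast
    linarith
  refine F.toLaurent_boxPoly_of_reflect I (key k h1 h0) fun J v hv => ?_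
  have := (key (-1 - k) (by linarith) (by linarith) J v hv).1
  rw [this]
  congr 1
  ring

end LatticeFrame

end WeightedEhrhart

/-! ### Generic vectors and the half-open decomposition of a complete fan. -/

namespace WeightedEhrhart

namespace StackyFan

open Module Filter Topology

variable {N : Type*} [AddCommGroup N]

/-- The full-dimensional cones of a fan. -/
def fullCones (S : StackyFan N) : Set (PointedCone ℝ (RealSpan N)) :=
  {σ | σ ∈ S.cones ∧ Submodule.span ℝ (σ : Set (RealSpan N)) = ⊤}

instance (S : StackyFan N) : Finite S.fullCones :=
  (S.finite.subset fun _ h => h.1).to_subtype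

/-- A line with direction outside `W` meets `W` at most once. -/
theorem eventually_add_smul_notMem {W : Submodule ℝ (RealSpan N)} {η : RealSpan N} (hη : η ∉ W)
    (ξ : RealSpan N) : ∀ᶠ ε : ℝ in 𝓝[>] 0, ξ + ε • η ∉ W := by
  have hs : {ε : ℝ | ξ + ε • η ∈ W}.Subsingleton := by
    intro a ha b hb
    by_contra hab
    have h := W.sub_mem ha hb
    rw [add_sub_add_left_eq_sub, ← sub_smul] at h
    exact hη ((W.smul_mem_iff (sub_ne_zero.2 hab)).1 h)
  have h1 : ∀ᶠ ε : ℝ in 𝓝[≠] 0, ξ + ε • η ∉ W :=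
    nhdsNE_le_cofinite 0 hs.finite.eventually_cofinite_notMem
  exact h1.filter_mono (nhdsWithin_mono _ fun _ h => ne_of_gt h)

theorem tendsto_add_mul (a b : ℝ) : Tendsto (fun ε : ℝ => a + ε * b) (𝓝[>] 0) (𝓝 a) := by
  have : Tendsto (fun ε : ℝ => a + ε * b) (𝓝 0) (𝓝 (a + 0 * b)) :=
    (by fun_prop : Continuous fun ε : ℝ => a + ε * b).tendsto 0
  rw [zero_mul, add_zero] at this
  exact this.mono_left nhdsWithin_le_nhds

variable [Module.Free ℤ N]

/-- The independent generators of a full-dimensional simplicial cone span its rays. Rescaled to the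
vectors `S.b ρ` they form a lattice frame, on which the linear form representing `ψ` takes only the
value 1. -/
theorem exists_frame [Module.Finite ℤ N] (S : StackyFan N) {σ : PointedCone ℝ (RealSpan N)}
    (hσ : σ ∈ S.fullCones) :
    ∃ F : LatticeFrame N, (∀ x, x ∈ σ ↔ ∀ i, 0 ≤ F.basis.repr x i) ∧
      ∀ x ∈ σ, S.psi x = ∑ i, F.basis.repr x i := by
  classical
  obtain ⟨hσc, hspan⟩ := hσ
  obtain ⟨G, hGfin, hG, rfl⟩ := S.simplicial σ hσc
  have := hGfin.fintype
  have hGspan : ⊤ ≤ Submodule.span ℝ (Set.range ((↑) : G → RealSpan N)) := by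
    rw [Subtype.range_coe, ← hspan, Submodule.span_le]
    exact PointedCone.hull_le_span (R := ℝ) G
  let B₀ : Basis G ℝ (RealSpan N) := Basis.mk hG hGspan
  have hcard : Fintype.card G = finrank ℤ N := by
    rw [← Module.finrank_eq_card_basis B₀]
    exact Module.finrank_baseChange
  let e : G ≃ Fin (finrank ℤ N) := Fintype.equivFinOfCardEq hcard
  have hray : ∀ g : G, PointedCone.hull ℝ {(g : RealSpan N)} ∈ S.rays :=
    fun g => hull_singleton_mem_rays S hG hσc g.2
  choose c hc hb using fun g : G => exists_b_eq S ⟨_, hray g⟩ rfl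
  let B : Basis (Fin (finrank ℤ N)) ℝ (RealSpan N) :=
    (B₀.unitsSMul fun g => Units.mk0 (c g) (hc g).ne').reindex e
  have hB : ∀ i, B i = c (e.symm i) • (e.symm i : RealSpan N) := by
    intro i
    simp [B, B₀, Basis.unitsSMul_apply, Units.smul_def]
  refine ⟨⟨fun i => S.b ⟨_, hray (e.symm i)⟩, B, fun i => by rw [hB, hb]⟩, ?_, ?_⟩
  · intro x
    constructor
    · intro hx i
      refine linearMap_nonneg_on_hull (l := B.coord i) (fun g hg => ?_) hx
      have h1 : g = (c ⟨g, hg⟩)⁻¹ • B (e ⟨g, hg⟩) := by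
        rw [hB, Equiv.symm_apply_apply, smul_smul, inv_mul_cancel₀ (hc _).ne', one_smul]
      rw [h1, map_smul, Basis.coord_apply, Basis.repr_self, smul_eq_mul, Finsupp.single_apply]
      have := (hc ⟨g, hg⟩).le
      split_ifs <;> positivity
    · intro hx
      rw [← B.sum_repr x]
      refine Submodule.sum_mem _ fun i _ => PointedCone.smul_mem _ (hx i) ?_
      rw [hB]
      exact PointedCone.smul_mem _ (hc _).le (Submodule.subset_span (e.symm i).2)
  · intro x hx
    obtain ⟨l, hl⟩ := S.isPsi_psi.linear_on_cone _ hσc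
    have hone : ∀ i, l (B i) = 1 := by
      intro i
      rw [hB, ← hb, ← S.isPsi_psi.apply_b ⟨_, hray (e.symm i)⟩]
      refine (hl _ ?_).symm
      rw [hb]
      exact PointedCone.smul_mem _ (hc _).le (Submodule.subset_span (e.symm i).2)
    rw [hl x hx]
    conv_lhs => rw [← B.sum_repr x]
    simp [map_sum, hone, -Basis.sum_repr]

variable [Module.Finite ℤ N] (S : StackyFan N)

/-- The frame of a full-dimensional cone, formed by the vectors `b ρ` of its rays. -/
noncomputable def frame (σ : S.fullCones) : LatticeFrame N := (S.exists_frame σ.2).choose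

theorem mem_iff_frame (σ : S.fullCones) (x : RealSpan N) :
    x ∈ σ.1 ↔ ∀ i, 0 ≤ (S.frame σ).basis.repr x i := (S.exists_frame σ.2).choose_spec.1 x

theorem psi_eq_frame (σ : S.fullCones) {x : RealSpan N} (hx : x ∈ σ.1) :
    S.psi x = ∑ i, (S.frame σ).basis.repr x i := (S.exists_frame σ.2).choose_spec.2 x hx

/-- The subspaces that a generic vector has to avoid. -/
def wallSpans : Set (Submodule ℝ (RealSpan N)) :=
  {W | W ≠ ⊤ ∧ ∃ σ ∈ S.cones, W = Submodule.span ℝ (σ : Set (RealSpan N))} ∪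
    Set.range fun p : S.fullCones × Fin (finrank ℤ N) =>
      LinearMap.ker ((S.frame p.1).basis.coord p.2)

theorem wallSpans_finite : S.wallSpans.Finite := by
  refine Set.Finite.union ?_ (Set.finite_range _)
  refine (S.finite.image fun σ : PointedCone ℝ (RealSpan N) =>
    Submodule.span ℝ (σ : Set (RealSpan N))).subset ?_
  rintro W ⟨-, σ, hσ, rfl⟩
  exact ⟨σ, hσ, rfl⟩

theorem top_notMem_wallSpans : ⊤ ∉ S.wallSpans := by
  rintro (h | ⟨p, hp⟩)
  · exact h.1 rfl
  · have : (S.frame p.1).basis p.2 ∈ LinearMap.ker ((S.frame p.1).basis.coord p.2) := by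
      rw [show LinearMap.ker ((S.frame p.1).basis.coord p.2) = ⊤ from hp]
      trivial
    simp at this

/-- A vector is generic if it avoids the spans of all cones of smaller dimension and the
coordinate hyperplanes of all full-dimensional cones. -/
def IsGeneric (ξ : RealSpan N) : Prop := ∀ W ∈ S.wallSpans, ξ ∉ W

variable {S}

theorem IsGeneric.neg {ξ : RealSpan N} (h : S.IsGeneric ξ) : S.IsGeneric (-ξ) :=
  fun W hW hm => h W hW (neg_mem_iff.1 hm)

theorem IsGeneric.repr_ne_zero {ξ : RealSpan N} (h : S.IsGeneric ξ) (σ : S.fullCones) (i) :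
    (S.frame σ).basis.repr ξ i ≠ 0 :=
  fun h0 => h _ (Or.inr ⟨(σ, i), rfl⟩) (by simpa using h0)

theorem IsGeneric.span_eq_top {ξ : RealSpan N} (h : S.IsGeneric ξ)
    {σ : PointedCone ℝ (RealSpan N)} (hσ : σ ∈ S.cones)
    (hξ : ξ ∈ Submodule.span ℝ (σ : Set (RealSpan N))) : σ ∈ S.fullCones := by
  refine ⟨hσ, ?_⟩
  by_contra hne
  exact h _ (Or.inl ⟨hne, σ, hσ, rfl⟩) hξ

variable (S)

/-- A real vector space is not a finite union of proper subspaces. -/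
theorem exists_isGeneric : ∃ ξ, S.IsGeneric ξ := by
  have h := Subspace.biUnion_ne_univ_of_top_notMem (s := S.wallSpans_finite.toFinset)
    (by simpa using S.top_notMem_wallSpans)
  obtain ⟨ξ, hξ⟩ := (Set.ne_univ_iff_exists_notMem _).1 h
  exact ⟨ξ, by simpa [IsGeneric] using hξ⟩

open Classical in
/-- The indices of the negative coordinates of `ξ` in a full-dimensional cone. -/
noncomputable def negSet (ξ : RealSpan N) (σ : S.fullCones) : Finset (Fin (finrank ℤ N)) :=
  Finset.univ.filter fun i => (S.frame σ).basis.repr ξ i < 0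

variable {S}

theorem mem_negSet {ξ : RealSpan N} {σ : S.fullCones} {i} :
    i ∈ S.negSet ξ σ ↔ (S.frame σ).basis.repr ξ i < 0 := by
  simp [negSet]

theorem IsGeneric.negSet_neg {ξ : RealSpan N} (h : S.IsGeneric ξ) (σ : S.fullCones) :
    S.negSet (-ξ) σ = (S.negSet ξ σ)ᶜ := by
  ext i
  have := h.repr_ne_zero σ i
  simp only [mem_negSet, Finset.mem_compl, map_neg, Finsupp.neg_apply, Left.neg_neg_iff, not_lt]
  exact ⟨le_of_lt, fun h => lt_of_le_of_ne h this.symm⟩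

-- A vector with the prescribed signs, here with coordinates `±1`, stays so under a small
-- perturbation in a generic direction, and the perturbation makes it generic.
variable (S) in
theorem exists_isGeneric_negSet_eq (σ : S.fullCones) (J : Finset (Fin (finrank ℤ N))) :
    ∃ ξ, S.IsGeneric ξ ∧ S.negSet ξ σ = J := by
  classical
  obtain ⟨η, hη⟩ := S.exists_isGeneric
  let ξ₀ : RealSpan N := (S.frame σ).basis.equivFun.symm fun i => if i ∈ J then -1 else 1
  have hξ₀ : ∀ i, (S.frame σ).basis.repr ξ₀ i = if i ∈ J then -1 else 1 := by
    intro i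
    rw [← Basis.equivFun_apply, LinearEquiv.apply_symm_apply]
  have h1 : ∀ᶠ ε : ℝ in 𝓝[>] 0, ∀ W ∈ S.wallSpans, ξ₀ + ε • η ∉ W :=
    (eventually_all_finite S.wallSpans_finite).2 fun W hW =>
      eventually_add_smul_notMem (hη W hW) ξ₀
  have h2 : ∀ᶠ ε : ℝ in 𝓝[>] 0, ∀ i, ((S.frame σ).basis.repr (ξ₀ + ε • η) i < 0 ↔ i ∈ J) := by
    refine eventually_all.2 fun i => ?_
    have ht := tendsto_add_mul ((S.frame σ).basis.repr ξ₀ i) ((S.frame σ).basis.repr η i)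
    by_cases hi : i ∈ J
    · rw [hξ₀ i, if_pos hi] at ht
      filter_upwards [ht.eventually (gt_mem_nhds (by norm_num : (-1 : ℝ) < 0))] with ε hε
      simpa [hi, hξ₀] using hε
    · rw [hξ₀ i, if_neg hi] at ht
      filter_upwards [ht.eventually (lt_mem_nhds (by norm_num : (0 : ℝ) < 1))] with ε hε
      simpa [hi, hξ₀] using hε.le
  obtain ⟨ε, hε1, hε2⟩ := (h1.and h2).exists
  refine ⟨ξ₀ + ε • η, hε1, ?_⟩
  ext i
  rw [mem_negSet, hε2]

variable (S) in
/-- The half-open version of a full-dimensional cone determined by `ξ`. -/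
def halfOpen (ξ : RealSpan N) (σ : S.fullCones) : Set (RealSpan N) :=
  {x | ∀ i, 0 ≤ (S.frame σ).basis.repr x i ∧
    (i ∈ S.negSet ξ σ → 0 < (S.frame σ).basis.repr x i)}

theorem halfOpen_subset {ξ : RealSpan N} {σ : S.fullCones} {x : RealSpan N}
    (hx : x ∈ S.halfOpen ξ σ) : x ∈ σ.1 := (S.mem_iff_frame σ x).2 fun i => (hx i).1

theorem IsGeneric.exists_mem_halfOpen (hS : S.IsComplete) {ξ : RealSpan N} (hξ : S.IsGeneric ξ)
    (x : RealSpan N) : ∃ σ, x ∈ S.halfOpen ξ σ := by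
  obtain ⟨σ, hσ, hfreq⟩ : ∃ σ ∈ S.cones, ∃ᶠ ε : ℝ in 𝓝[>] 0, x + ε • ξ ∈ σ := by
    by_contra! h
    have h1 : ∀ᶠ ε : ℝ in 𝓝[>] 0, ∀ σ ∈ S.cones, x + ε • ξ ∉ σ :=
      (eventually_all_finite S.finite).2 fun σ hσ => h σ hσ
    obtain ⟨ε, hε⟩ := h1.exists
    have : x + ε • ξ ∈ S.support := by
      rw [show S.support = Set.univ from hS]
      trivial
    obtain ⟨σ, hσ, hmem⟩ := this
    exact hε σ hσ hmem
  have hpos : ∀ᶠ ε : ℝ in 𝓝[>] 0, 0 < ε := self_mem_nhdsWithin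
  -- Two different values of `ε` with `x + ε • ξ ∈ σ` put `ξ` in the span of `σ`, which genericity
  -- allows only if the span is everything.
  have hfull : σ ∈ S.fullCones := by
    obtain ⟨a, ha, ha0⟩ := (hfreq.and_eventually hpos).exists
    obtain ⟨b, hb, hba⟩ := (hfreq.and_eventually
      ((gt_mem_nhds ha0).filter_mono nhdsWithin_le_nhds)).exists
    refine hξ.span_eq_top hσ ?_
    have h := Submodule.sub_mem _ (Submodule.subset_span (R := ℝ) ha)
      (Submodule.subset_span (R := ℝ) hb)
    rw [add_sub_add_left_eq_sub, ← sub_smul] at h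
    exact (Submodule.smul_mem_iff _ (sub_ne_zero.2 (ne_of_gt hba))).1 h
  have hcoord : ∀ i, ∃ᶠ ε : ℝ in 𝓝[>] 0, 0 ≤ (S.frame ⟨σ, hfull⟩).basis.repr x i +
      ε * (S.frame ⟨σ, hfull⟩).basis.repr ξ i := by
    intro i
    refine hfreq.mono fun ε hε => ?_
    simpa using (S.mem_iff_frame ⟨σ, hfull⟩ _).1 hε i
  -- The weak inequality follows as `ε` tends to 0; the strict one because a negative coordinate of
  -- `ξ` must be compensated by `x`.
  refine ⟨⟨σ, hfull⟩, fun i => ⟨?_, fun hi => ?_⟩⟩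
  · by_contra! hneg
    have := (tendsto_add_mul ((S.frame ⟨σ, hfull⟩).basis.repr x i)
      ((S.frame ⟨σ, hfull⟩).basis.repr ξ i)).eventually (gt_mem_nhds hneg)
    obtain ⟨ε, h1, h2⟩ := ((hcoord i).and_eventually this).exists
    linarith
  · obtain ⟨ε, h1, h2⟩ := ((hcoord i).and_eventually hpos).exists
    have := mul_neg_of_pos_of_neg h2 (mem_negSet.1 hi)
    linarith

/-- The face `σ ⊓ τ` of `σ` contains the interior point `y`. As `y` is a positive combination of the
generators of `σ`, the face contains each of them. -/
theorem le_of_pos_of_mem {σ τ : S.fullCones} {y : RealSpan N}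
    (hy : ∀ i, 0 < (S.frame σ).basis.repr y i) (hτ : y ∈ τ.1) : σ.1 ≤ τ.1 := by
  classical
  have hface := (S.inter_face _ σ.2.1 _ τ.2.1).1
  have hyσ : y ∈ σ.1 := (S.mem_iff_frame σ y).2 fun i => (hy i).le
  have hB : ∀ i, (S.frame σ).basis i ∈ σ.1 := by
    intro i
    refine (S.mem_iff_frame σ _).2 fun j => ?_
    rw [Basis.repr_self, Finsupp.single_apply]
    split_ifs <;> norm_num
  have hBτ : ∀ i, (S.frame σ).basis i ∈ σ.1 ⊓ τ.1 := by
    intro i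
    refine hface.mem_of_smul_add_mem (y := ∑ j ∈ Finset.univ.erase i,
      (S.frame σ).basis.repr y j • (S.frame σ).basis j) (hB i) ?_ (hy i) ?_
    · exact Submodule.sum_mem _ fun j _ => PointedCone.smul_mem _ (hy j).le (hB j)
    · rw [Finset.add_sum_erase _ (fun j => (S.frame σ).basis.repr y j • (S.frame σ).basis j)
        (Finset.mem_univ i), Basis.sum_repr]
      exact ⟨hyσ, hτ⟩
  intro x hx
  rw [← (S.frame σ).basis.sum_repr x]
  exact Submodule.sum_mem _ fun i _ =>
    PointedCone.smul_mem _ ((S.mem_iff_frame σ x).1 hx i) (hBτ i).2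

theorem IsGeneric.eventually_pos {ξ : RealSpan N} (hξ : S.IsGeneric ξ) {σ : S.fullCones}
    {x : RealSpan N} (hx : x ∈ S.halfOpen ξ σ) :
    ∀ᶠ ε : ℝ in 𝓝[>] 0, ∀ i, 0 < (S.frame σ).basis.repr (x + ε • ξ) i := by
  refine eventually_all.2 fun i => ?_
  have hpos : ∀ᶠ ε : ℝ in 𝓝[>] 0, 0 < ε := self_mem_nhdsWithin
  rcases lt_or_gt_of_ne (hξ.repr_ne_zero σ i) with hi | hi
  · filter_upwards [(tendsto_add_mul _ ((S.frame σ).basis.repr ξ i)).eventually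
      (lt_mem_nhds ((hx i).2 (mem_negSet.2 hi)))] with ε hε
    simpa using hε
  · filter_upwards [hpos] with ε hε
    simpa using add_pos_of_nonneg_of_pos (hx i).1 (mul_pos hε hi)

/-- For small `ε` the point `x + ε • ξ` is interior to both cones, so each contains the other. -/
theorem IsGeneric.halfOpen_unique {ξ : RealSpan N} (hξ : S.IsGeneric ξ) {σ τ : S.fullCones}
    {x : RealSpan N} (hσ : x ∈ S.halfOpen ξ σ) (hτ : x ∈ S.halfOpen ξ τ) : σ = τ := by
  obtain ⟨ε, h1, h2⟩ := ((hξ.eventually_pos hσ).and (hξ.eventually_pos hτ)).exists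
  exact Subtype.ext (le_antisymm
    (le_of_pos_of_mem h1 ((S.mem_iff_frame τ _).2 fun i => (h2 i).le))
    (le_of_pos_of_mem h2 ((S.mem_iff_frame σ _).2 fun i => (h1 i).le)))

theorem IsComplete.exists_mem_fullCones (hS : S.IsComplete) (x : RealSpan N) :
    ∃ σ : S.fullCones, x ∈ σ.1 := by
  obtain ⟨ξ, hξ⟩ := S.exists_isGeneric
  obtain ⟨σ, hσ⟩ := hξ.exists_mem_halfOpen hS x
  exact ⟨σ, halfOpen_subset hσ⟩

theorem mem_smul_Q_iff (hS : S.IsComplete) (m : ℕ) (x : RealSpan N) :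
    x ∈ (m : ℝ) • S.Q ↔ S.psi x ≤ m := by
  have hsupp : ∀ y, y ∈ S.support := fun y => by
    rw [show S.support = Set.univ from hS]
    trivial
  have hsmul : ∀ (c : ℝ) (y : RealSpan N), 0 ≤ c → S.psi (c • y) = c * S.psi y := by
    intro c y hc
    obtain ⟨σ, hσ⟩ := IsComplete.exists_mem_fullCones hS y
    rw [S.psi_eq_frame σ hσ, S.psi_eq_frame σ (PointedCone.smul_mem _ hc hσ), Finset.mul_sum]
    simp
  have h0 : S.psi 0 = 0 := by simpa using hsmul 0 0 le_rfl
  have hQ0 : (0 : RealSpan N) ∈ S.Q := ⟨hsupp 0, by rw [h0]; norm_num⟩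
  -- The dilate by 0 is just `{0}`, so this case needs that `ψ` is positive away from the origin;
  -- for `m > 0` homogeneity suffices.
  rcases Nat.eq_zero_or_pos m with rfl | hm
  · rw [Nat.cast_zero, Set.zero_smul_set ⟨0, hQ0⟩, Set.mem_zero]
    constructor
    · rintro rfl
      exact h0.le
    · intro hx
      obtain ⟨σ, hσ⟩ := IsComplete.exists_mem_fullCones hS x
      have hnn := (S.mem_iff_frame σ x).1 hσ
      rw [S.psi_eq_frame σ hσ] at hx
      have h1 := (Finset.sum_eq_zero_iff_of_nonneg fun i _ => hnn i).1
        (le_antisymm hx (Finset.sum_nonneg fun i _ => hnn i))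
      apply (S.frame σ).basis.repr.injective
      ext i
      simpa using h1 i (Finset.mem_univ i)
  · have hm' : (0 : ℝ) < m := by exact_mod_cast hm
    rw [Set.mem_smul_set_iff_inv_smul_mem₀ hm'.ne']
    have : (m : ℝ)⁻¹ • x ∈ S.Q ↔ S.psi ((m : ℝ)⁻¹ • x) ≤ 1 := ⟨fun h => h.2, fun h => ⟨hsupp _, h⟩⟩
    rw [this, hsmul _ _ (by positivity), inv_mul_le_iff₀ hm', mul_one]

theorem psi_eq_height (σ : S.fullCones) {v : N} (hv : latticePoint v ∈ σ.1) :
    S.psi (latticePoint v) = (S.frame σ).height v := S.psi_eq_frame σ hv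

variable (S) in
/-- The sum of the generating polynomials of the half-open parallelepipeds of all full-dimensional
cones. -/
noncomputable def boxSum (ξ : RealSpan N) (k : ℚ) : Polynomial ℤ :=
  ∑ᶠ σ : S.fullCones, (S.frame σ).boxPoly (S.negSet ξ σ) k

theorem IsGeneric.count_eq (hS : S.IsComplete) {ξ : RealSpan N} (hξ : S.IsGeneric ξ) (k : ℚ)
    (m : ℕ) : S.count k m = ∑ᶠ σ : S.fullCones,
      {v | v ∈ (S.frame σ).halfOpenCone (S.negSet ξ σ) ∧ ⌈(S.frame σ).height v⌉₊ ≤ m ∧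
        (S.frame σ).height v - ⌈(S.frame σ).height v⌉ = (k : ℝ)}.ncard := by
  rw [← Set.ncard_iUnion_of_finite fun σ => ((S.frame σ).cone_count (S.negSet ξ σ) k m).1]
  · rw [count]
    congr 1
    ext v
    simp only [Set.mem_ofPred_eq, Set.mem_iUnion, mem_smul_Q_iff hS, weight]
    constructor
    · rintro ⟨h1, h2⟩
      obtain ⟨σ, hσ⟩ := hξ.exists_mem_halfOpen hS (latticePoint v)
      rw [psi_eq_height σ (halfOpen_subset hσ)] at h1 h2
      exact ⟨σ, hσ, Nat.ceil_le.2 h1, h2⟩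
    · rintro ⟨σ, hσ, h1, h2⟩
      rw [psi_eq_height σ (halfOpen_subset (ξ := ξ) hσ)]
      exact ⟨Nat.ceil_le.1 h1, h2⟩
  · intro σ τ hne
    refine Set.disjoint_left.2 fun v hv hv' => hne (hξ.halfOpen_unique (x := latticePoint v)
      hv.1 hv'.1)

theorem IsGeneric.boxSum_coe (hS : S.IsComplete) {ξ : RealSpan N} (hξ : S.IsGeneric ξ) (k : ℚ) :
    (S.boxSum ξ k : PowerSeries ℤ) = S.deltaSeries k := by
  have := Fintype.ofFinite S.fullCones
  rw [boxSum, finsum_eq_sum_of_fintype, ← Polynomial.coeToPowerSeries.ringHom_apply, map_sum]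
  simp only [Polynomial.coeToPowerSeries.ringHom_apply, LatticeFrame.boxPoly_coe]
  rw [← Finset.mul_sum, deltaSeries]
  congr 1
  ext m
  simp [hξ.count_eq hS k m, finsum_eq_sum_of_fintype, PowerSeries.coeff_mk]

end StackyFan

end WeightedEhrhart

/-! ### Independence of the generic vector, positivity and symmetry. -/

namespace WeightedEhrhart

open Module

namespace StackyFan

variable {N : Type*} [AddCommGroup N] [Module.Free ℤ N] [Module.Finite ℤ N] {S : StackyFan N}

/-- Both sides represent `S.deltaSeries k`, whose definition involves no choice of vector. -/
theorem IsGeneric.boxSum_eq (hS : S.IsComplete) {ξ ξ' : RealSpan N} (hξ : S.IsGeneric ξ)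
    (hξ' : S.IsGeneric ξ') (k : ℚ) : S.boxSum ξ k = S.boxSum ξ' k :=
  Polynomial.coe_inj.1 ((hξ.boxSum_coe hS k).trans (hξ'.boxSum_coe hS k).symm)

theorem boxSum_eq_zero {ξ : RealSpan N} {k : ℚ} (hk : ¬ (-1 < k ∧ k ≤ 0)) :
    S.boxSum ξ k = 0 :=
  finsum_eq_zero_of_forall_eq_zero fun σ => by
    rw [LatticeFrame.boxPoly, LatticeFrame.boxPoints_eq_empty _ _ hk, Finset.sum_empty]

variable (S) in
theorem boxSum_support_finite (ξ : RealSpan N) : {k | S.boxSum ξ k ≠ 0}.Finite := by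
  refine (Set.finite_iUnion fun σ : S.fullCones =>
    (S.frame σ).setOf_boxPoints_nonempty_finite (S.negSet ξ σ)).subset ?_
  intro k hk
  by_contra h
  simp only [Set.mem_iUnion, Set.mem_ofPred_eq, not_exists, not_not] at h
  exact hk (finsum_eq_zero_of_forall_eq_zero fun σ => by
    rw [LatticeFrame.boxPoly, h σ, Finset.sum_empty])

theorem boxSum_natDegree_le (ξ : RealSpan N) (k : ℚ) :
    (S.boxSum ξ k).natDegree ≤ finrank ℤ N := by
  have := Fintype.ofFinite S.fullCones
  rw [boxSum, finsum_eq_sum_of_fintype]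
  exact Polynomial.natDegree_sum_le_of_forall_le _ _ fun σ _ =>
    (S.frame σ).boxPoly_natDegree_le _ k

theorem IsGeneric.boxSum_coeff_pos (hS : S.IsComplete) {ξ : RealSpan N} (hξ : S.IsGeneric ξ)
    {i : ℕ} (hi : i ≤ finrank ℤ N) : 0 < (S.boxSum ξ 0).coeff i := by
  have := Fintype.ofFinite S.fullCones
  obtain ⟨σ, -⟩ := IsComplete.exists_mem_fullCones hS 0
  obtain ⟨J, -, rfl⟩ := Finset.exists_subset_card_eq
    (s := (Finset.univ : Finset (Fin (finrank ℤ N)))) (by simpa using hi)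
  -- Changing to a vector adapted to `J` makes the `σ`-term contribute in degree `J.card`; all other
  -- terms are nonnegative.
  obtain ⟨ξ', hξ', hJ⟩ := S.exists_isGeneric_negSet_eq σ J
  rw [hξ.boxSum_eq hS hξ', boxSum, finsum_eq_sum_of_fintype, Polynomial.finsetSum_coeff]
  refine Finset.sum_pos' (fun τ _ => (S.frame τ).boxPoly_coeff_nonneg _ _ _)
    ⟨σ, Finset.mem_univ _, ?_⟩
  rw [hJ]
  exact (S.frame σ).boxPoly_coeff_card_pos J

theorem IsGeneric.toLaurent_boxSum_of_boxPoly (hS : S.IsComplete) {ξ : RealSpan N}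
    (hξ : S.IsGeneric ξ) {k k' : ℚ} {e : ℤ}
    (h : ∀ (F : LatticeFrame N) I, Polynomial.toLaurent (F.boxPoly I k) = LaurentPolynomial.T e *
      LaurentPolynomial.invert (Polynomial.toLaurent (F.boxPoly Iᶜ k'))) :
    Polynomial.toLaurent (S.boxSum ξ k) = LaurentPolynomial.T e *
      LaurentPolynomial.invert (Polynomial.toLaurent (S.boxSum ξ k')) := by
  have := Fintype.ofFinite S.fullCones
  -- Passing to `-ξ` on the right replaces every negative set by its complement, as the reflection
  -- of a single box requires.
  rw [hξ.boxSum_eq hS hξ.neg k']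
  simp only [boxSum, finsum_eq_sum_of_fintype, map_sum, Finset.mul_sum, hξ.negSet_neg]
  exact Finset.sum_congr rfl fun σ _ => h _ _

theorem IsGeneric.toLaurent_boxSum_zero (hS : S.IsComplete) {ξ : RealSpan N}
    (hξ : S.IsGeneric ξ) : Polynomial.toLaurent (S.boxSum ξ 0) =
      LaurentPolynomial.T (finrank ℤ N) *
        LaurentPolynomial.invert (Polynomial.toLaurent (S.boxSum ξ 0)) :=
  hξ.toLaurent_boxSum_of_boxPoly hS fun F I => F.toLaurent_boxPoly_zero I

theorem IsGeneric.toLaurent_boxSum_neg (hS : S.IsComplete) {ξ : RealSpan N}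
    (hξ : S.IsGeneric ξ) {k : ℚ} (h1 : -1 < k) (h0 : k < 0) :
    Polynomial.toLaurent (S.boxSum ξ k) = LaurentPolynomial.T ((finrank ℤ N : ℤ) + 1) *
      LaurentPolynomial.invert (Polynomial.toLaurent (S.boxSum ξ (-1 - k))) :=
  hξ.toLaurent_boxSum_of_boxPoly hS fun F I => F.toLaurent_boxPoly_neg I h1 h0

theorem X_dvd_boxSum (ξ : RealSpan N) {k : ℚ} (hk : k ≠ 0) :
    Polynomial.X ∣ S.boxSum ξ k := by
  have := Fintype.ofFinite S.fullCones
  rw [boxSum, finsum_eq_sum_of_fintype]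
  refine Finset.dvd_sum fun σ _ => Finset.dvd_sum fun p hp => ?_
  exact dvd_pow_self _ (Nat.one_le_iff_ne_zero.1 ((S.frame σ).one_le_ceil hk hp))

end StackyFan

/-! ### Laurent polynomials with rational exponents and the weighted sum. -/

namespace FracPoly

/-- The inclusion of Laurent polynomials into polynomials in rational powers of `t`. -/
noncomputable def ofLaurent : LaurentPolynomial ℤ →+* FracPoly :=
  AddMonoidAlgebra.mapDomainRingHom ℤ (Int.castAddHom ℚ)

theorem ofLaurent_T (n : ℤ) : ofLaurent (LaurentPolynomial.T n) = T n := by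
  rw [ofLaurent, LaurentPolynomial.T, T, AddMonoidAlgebra.mapDomainRingHom_apply,
    AddMonoidAlgebra.mapDomain_single]
  rfl

theorem T_add (p q : ℚ) : T (p + q) = T p * T q := by
  simp [T, AddMonoidAlgebra.single_mul_single]

theorem invert_T (q : ℚ) : invert (T q) = T (-q) := by
  simp [invert, T]

theorem ofLaurent_toLaurent (p : Polynomial ℤ) :
    ofLaurent (Polynomial.toLaurent p) = ofPolynomial p := by
  have h : (ofLaurent.comp Polynomial.toLaurent : Polynomial ℤ →+* FracPoly) =
      (ofPolynomial : Polynomial ℤ →+* FracPoly) := by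
    apply Polynomial.ringHom_ext'
    · exact RingHom.ext_int _ _
    · simp [ofPolynomial, Polynomial.toLaurent_X, ofLaurent_T]
  exact congrArg (fun f => f p) h

theorem ofLaurent_invert (p : LaurentPolynomial ℤ) :
    ofLaurent (LaurentPolynomial.invert p) = invert (ofLaurent p) := by
  induction p using LaurentPolynomial.induction_on' with
  | add p q hp hq => simp [hp, hq]
  | C_mul_T n a =>
    simp only [map_mul, LaurentPolynomial.invert_C, LaurentPolynomial.invert_T, ofLaurent_T,
      invert_T, Int.cast_neg]
    congr 1
    simp

/-- A family of polynomials whose members are exchanged by `k ↦ -1 - k` up to reflection has a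
palindromic weighted sum. -/
theorem weightedSum_symm {δ : ℚ → Polynomial ℤ} {d : ℕ} (hfin : {k | δ k ≠ 0}.Finite)
    (hsupp : ∀ k, δ k ≠ 0 → -1 < k ∧ k ≤ 0)
    (h0 : Polynomial.toLaurent (δ 0) = LaurentPolynomial.T d *
      LaurentPolynomial.invert (Polynomial.toLaurent (δ 0)))
    (hneg : ∀ k, -1 < k → k < 0 → Polynomial.toLaurent (δ k) =
      LaurentPolynomial.T ((d : ℤ) + 1) *
        LaurentPolynomial.invert (Polynomial.toLaurent (δ (-1 - k)))) :
    weightedSum δ = T d * invert (weightedSum δ) := by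
  -- The weight 0 is its own partner, so -1 must be fixed as well for `e` to be an involution of
  -- `ℚ`; the sum can then be reindexed along `e`.
  let e : ℚ → ℚ := fun k => if k = 0 ∨ k = -1 then k else -1 - k
  have he : Function.Involutive e := by
    intro k
    by_cases hk : k = 0 ∨ k = -1
    · simp [e, hk]
    · have h' : ¬ (-1 - k = 0 ∨ -1 - k = -1) := by
        rintro (h | h)
        · exact hk (Or.inr (by linarith))
        · exact hk (Or.inl (by linarith))
      simp only [e, if_neg hk, if_neg h']
      ring
  have hterm : ∀ k, ofPolynomial (δ (e k)) * T (e k) =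
      T d * invert (ofPolynomial (δ k) * T k) := by
    intro k
    rw [map_mul, invert_T]
    by_cases hk0 : k = 0
    · subst hk0
      have := congrArg ofLaurent h0
      rw [map_mul, ofLaurent_invert, ofLaurent_toLaurent, ofLaurent_T] at this
      simp only [e, true_or, if_true, neg_zero]
      conv_lhs => rw [this]
      simp [mul_assoc]
    · by_cases hk : -1 < k ∧ k < 0
      · have he' : e k = -1 - k := if_neg (by
          rintro (h | h)
          · exact hk0 h
          · linarith [hk.1])
        have := congrArg ofLaurent (hneg (-1 - k) (by linarith) (by linarith))
        rw [sub_sub_cancel, map_mul, ofLaurent_invert, ofLaurent_toLaurent, ofLaurent_toLaurent,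
          ofLaurent_T] at this
        -- The extra 1 in `d + 1` is absorbed by the weights: `(d + 1) + (-1 - k) = d - k`.
        rw [he', this, mul_right_comm, ← T_add, mul_left_comm, ← T_add, mul_comm]
        congr 2
        push_cast
        ring
      · have h1 : δ k = 0 := by
          by_contra hne
          obtain ⟨ha, hb⟩ := hsupp k hne
          exact hk ⟨ha, lt_of_le_of_ne hb hk0⟩
        have h2 : δ (e k) = 0 := by
          by_contra hne
          obtain ⟨ha, hb⟩ := hsupp _ hne
          by_cases hk1 : k = -1
          · subst hk1
            simp [e] at ha
          · have he' : e k = -1 - k := if_neg (by simp [hk0, hk1])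
            rw [he'] at ha hb
            exact hk ⟨lt_of_le_of_ne (by linarith) (Ne.symm hk1), by linarith⟩
        simp [h1, h2]
  have hfs : (Function.support fun k => ofPolynomial (δ k) * T k).Finite := by
    refine hfin.subset fun k hk h => hk ?_
    simp [show δ k = 0 from h]
  calc weightedSum δ = ∑ᶠ k, ofPolynomial (δ (e k)) * T (e k) :=
        (finsum_comp_equiv he.toPerm (f := fun k => ofPolynomial (δ k) * T k)).symm
    _ = ∑ᶠ k, T d * invert (ofPolynomial (δ k) * T k) := finsum_congr hterm
    _ = T d * invert (weightedSum δ) := by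
      rw [weightedSum]
      exact (((AddMonoidHom.mulLeft (T d)).comp (invert : FracPoly →+ FracPoly)).map_finsum
        hfs).symm

end FracPoly

end WeightedEhrhart

/-! ### The main theorem. -/

theorem corollary3p4 {N : Type*} [AddCommGroup N] [Module.Free ℤ N] [Module.Finite ℤ N]
    (S : WeightedEhrhart.StackyFan N) (hS : S.IsComplete) :
    ∃ δ : ℚ → Polynomial ℤ,
      -- `δ k` is the polynomial `δ⁰ₖ(t)`; it vanishes unless `-1 < k ≤ 0`, and for almost all `k`
      (∀ k, (δ k : PowerSeries ℤ) = S.deltaSeries k) ∧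
      (∀ k, δ k ≠ 0 → -1 < k ∧ k ≤ 0) ∧
      {k | δ k ≠ 0}.Finite ∧
      -- `δ⁰₀(t)` has degree `d` and positive coefficients
      (δ 0).natDegree = Module.finrank ℤ N ∧
      (∀ i ≤ Module.finrank ℤ N, 0 < (δ 0).coeff i) ∧
      -- symmetry of `δ⁰(t)`
      WeightedEhrhart.FracPoly.weightedSum δ =
        WeightedEhrhart.FracPoly.T (Module.finrank ℤ N) *
          WeightedEhrhart.FracPoly.invert (WeightedEhrhart.FracPoly.weightedSum δ) ∧
      -- symmetry of `δ⁰₀(t)`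
      Polynomial.toLaurent (δ 0) =
        LaurentPolynomial.T (Module.finrank ℤ N) *
          LaurentPolynomial.invert (Polynomial.toLaurent (δ 0)) ∧
      -- `δ⁰ₖ(t) = t δ̃ₖ(t)` for `-1 < k < 0`, and the symmetry of the `δ̃ₖ(t)`
      ∃ δ' : ℚ → Polynomial ℤ,
        (∀ k, -1 < k → k < 0 → δ k = Polynomial.X * δ' k) ∧
        (∀ k, -1 < k → k < 0 →
          Polynomial.toLaurent (δ' k) =
            LaurentPolynomial.T ((Module.finrank ℤ N : ℤ) - 1) *
              LaurentPolynomial.invert (Polynomial.toLaurent (δ' (-1 - k)))) := by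
  obtain ⟨ξ, hξ⟩ := S.exists_isGeneric
  have hsupp : ∀ k, S.boxSum ξ k ≠ 0 → -1 < k ∧ k ≤ 0 := fun k hk => by
    by_contra h
    exact hk (WeightedEhrhart.StackyFan.boxSum_eq_zero h)
  have hpos : ∀ i ≤ Module.finrank ℤ N, 0 < (S.boxSum ξ 0).coeff i :=
    fun i hi => hξ.boxSum_coeff_pos hS hi
  have hdvd : ∀ k : ℚ, ∃ p : Polynomial ℤ, k ≠ 0 → S.boxSum ξ k = Polynomial.X * p := by
    intro k
    by_cases hk : k = 0
    · exact ⟨0, fun h => (h hk).elim⟩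
    · obtain ⟨p, hp⟩ := WeightedEhrhart.StackyFan.X_dvd_boxSum (S := S) ξ hk
      exact ⟨p, fun _ => hp⟩
  choose δ' hδ' using hdvd
  refine ⟨S.boxSum ξ, hξ.boxSum_coe hS, hsupp, S.boxSum_support_finite ξ, ?_, hpos, ?_,
    hξ.toLaurent_boxSum_zero hS, δ', fun k _ h0 => hδ' k h0.ne, ?_⟩
  · exact le_antisymm (WeightedEhrhart.StackyFan.boxSum_natDegree_le ξ 0)
      (Polynomial.le_natDegree_of_ne_zero (hpos _ le_rfl).ne')
  · exact WeightedEhrhart.FracPoly.weightedSum_symm (S.boxSum_support_finite ξ) hsupp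
      (hξ.toLaurent_boxSum_zero hS) fun k h1 h0 => hξ.toLaurent_boxSum_neg hS h1 h0
  · intro k h1 h0
    have h := hξ.toLaurent_boxSum_neg hS h1 h0
    rw [hδ' k h0.ne, hδ' (-1 - k) (by linarith), map_mul, map_mul, map_mul,
      Polynomial.toLaurent_X, LaurentPolynomial.invert_T, ← mul_assoc,
      ← LaurentPolynomial.T_add] at h
    -- Each side carries a factor `t` before reflection; removing both lowers the exponent from `d +
    -- 1` to `d - 1`.
    have h' := congrArg (LaurentPolynomial.T (-1) * ·) h
    simp only [← mul_assoc, ← LaurentPolynomial.T_add] at h'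
    rw [neg_add_cancel, LaurentPolynomial.T_zero, one_mul] at h'
    rw [h']
    congr 2
    ring
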